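/- Let $K$ be a field. For a finite simple graph $G$ with vertex set $V$, let $J_G$ be its binomial edge ideal, i.e. the ideal of the polynomial ring $K[x_v,y_v : v\in V]$ generated by the binomials $x_iy_j-x_jy_i$ with $\{i,j\}$ an edge of $G$. A vertex of a graph is a cut point if deleting it gives a graph with more connected components. Let $\mathcal{C}(G)$ be the collection consisting of $\emptyset$ and of all $T\subseteq V$ such that every $i\in T$ is a cut point of the subgraph of $G$ induced on $(V\setminus T)\cup\{i\}$. For collections $\mathcal{A},\mathcal{B}$ of sets put $\mathcal{A}\circ\mathcal{B}=\{A\cup B : A\in\mathcal{A},\,B\in\mathcal{B}\}$, and $\bigcirc_{i=1}^{t}\mathcal{A}_i=\{A_1\cup\dots\cup A_t : A_i\in\mathcal{A}_i\}$. The join $G_1*G_2$ of two graphs on disjoint vertex sets is obtained from their disjoint union by adding all edges between a vertex of $G_1$ and a vertex of $G_2$. Proposition 4.10. Let $G_1=\bigsqcup_{i=1}^{r}G_{1i}$ and $G_2=\bigsqcup_{j=1}^{s}G_{2j}$ be finite simple graphs on disjoint vertex sets $V_1$ and $V_2$, where $G_{11},\dots,G_{1r}$ are the connected components of $G_1$,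 $G_{21},\dots,G_{2s}$ are the connected components of $G_2$, and $r,s\ge 2$. Let $V_{1i}$, $V_{2j}$ be the vertex sets of $G_{1i}$, $G_{2j}$, and put $n_1=|V_1|$, $n_2=|V_2|$, $S=K[x_v,y_v : v\in V_1\cup V_2]$, $S_{1i}=K[x_v,y_v : v\in V_{1i}]$, $S_{2j}=K[x_v,y_v : v\in V_{2j}]$. Then: (a) $\mathcal{C}(G_1*G_2)=\{\emptyset\}\cup\Big(\big(\bigcirc_{i=1}^{r}\mathcal{C}(G_{1i})\big)\circ\{V_2\}\Big)\cup\Big(\big(\bigcirc_{j=1}^{s}\mathcal{C}(G_{2j})\big)\circ\{V_1\}\Big)$; (b) $\operatorname{height} J_{G_1*G_2}=\min\Big\{2n_2+\sum_{i=1}^{r}\operatorname{height}J_{G_{1i}},\ 2n_1+\sum_{j=1}^{s}\operatorname{height}J_{G_{2j}},\ n_1+n_2-1\Big\}$; (c) $\dim S/J_{G_1*G_2}=\max\Big\{\sum_{i=1}^{r}\dim S_{1i}/J_{G_{1i}},\ \sum_{j=1}^{s}\dim S_{2j}/J_{G_{2j}},\ n_1+n_2+1\Big\}$. -/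

import Mathlib

/-- A vertex `v` of a (finite) graph `G` is a cut point if deleting `v` from `G` yields a graph
with more connected components than `G`. -/
def IsCutPoint {V : Type*} (G : SimpleGraph V) (v : V) : Prop :=
  Nat.card G.ConnectedComponent < Nat.card (G.induce {w | w ≠ v}).ConnectedComponent

/-- `T` has the cut point property for `G`: every `i ∈ T` is a cut point of the subgraph of `G`
induced on `(V \ T) ∪ {i}`. -/
def HasCutPointProperty {V : Type*} (G : SimpleGraph V) (T : Set V) : Prop :=
  ∀ i ∈ T, IsCutPoint (G.induce (Tᶜ ∪ {i})) ⟨i, Or.inr rfl⟩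

/-- The collection `𝒞(G)`: the empty set together with the sets having the cut point property. -/
def cutPointSets {V : Type*} (G : SimpleGraph V) : Set (Set V) :=
  {∅} ∪ {T | HasCutPointProperty G T}

/-- The join `G * H`: the disjoint union of `G` and `H` together with all edges between them. -/
def graphJoin {V W : Type*} (G : SimpleGraph V) (H : SimpleGraph W) : SimpleGraph (V ⊕ W) :=
  SimpleGraph.sum G H ⊔ completeBipartiteGraph V W

/-- The join `𝒜 ∘ ℬ = {A ∪ B : A ∈ 𝒜, B ∈ ℬ}` of two collections of subsets. -/
def joinCollections {V : Type*} (𝒜 ℬ : Set (Set V)) : Set (Set V) :=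
  {T | ∃ A ∈ 𝒜, ∃ B ∈ ℬ, T = A ∪ B}

/-- The join `○ᵢ 𝒜ᵢ = {⋃ᵢ Aᵢ : Aᵢ ∈ 𝒜ᵢ}` of a family of collections of subsets. -/
def iJoinCollections {ι V : Type*} (𝒜 : ι → Set (Set V)) : Set (Set V) :=
  {T | ∃ A : ι → Set V, (∀ i, A i ∈ 𝒜 i) ∧ T = ⋃ i, A i}

/-- The collection of subsets of `V` obtained by viewing the members of `𝒜`, which are sets of
vertices of the connected component `c`, as subsets of `V`. -/
def liftCollection {V : Type*} {G : SimpleGraph V} (c : G.ConnectedComponent)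
    (𝒜 : Set (Set c)) : Set (Set V) :=
  {T | ∃ A ∈ 𝒜, T = Subtype.val '' A}

/-- `K[x_v, y_v : v ∈ V]`; the variable `x_v` is indexed by `(0, v)` and `y_v` by `(1, v)`. -/
abbrev EdgeRing (K : Type*) [Field K] (V : Type*) : Type _ :=
  MvPolynomial (Fin 2 × V) K

/-- The binomial edge ideal `J_G`, generated by `x_i y_j - x_j y_i` for the edges `{i, j}` of `G`.
Exchanging `i` and `j` only changes the sign of the generator, so no order on `V` is needed. -/
noncomputable def binomialEdgeIdeal (K : Type*) [Field K] {V : Type*} (G : SimpleGraph V) :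
    Ideal (EdgeRing K V) :=
  Ideal.span {f | ∃ i j, G.Adj i j ∧
    f = MvPolynomial.X (0, i) * MvPolynomial.X (1, j)
      - MvPolynomial.X (0, j) * MvPolynomial.X (1, i)}

/-
Let `P` be a prime ideal containing `J_G` and let `U` be the set of vertices `v` such that `x_v`
and `y_v` do not both vanish modulo `P`. Modulo `P` the vectors `(x_v, y_v)` and `(x_w, y_w)` of
adjacent vertices are proportional, so all the `x_v`, `y_v` are determined by one slope for each
component of `G[U]` and one scale for each vertex of `U`; hence `P` has height at least
`2n - |U| - c(G[U])`, where `n` is the number of vertices. Conversely, for any `U`, letting slopes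
and scales vary freely parametrises part of the zero set of `J_G`, and specialising them one at a
time gives a chain of primes of length `|U| + c(G[U])` above `J_G`. So
`dim S/J_G = max_U (|U| + c(G[U]))` and `height J_G = 2n - dim S/J_G`, both are additive over
connected components, and the cut point property can be checked on each component.

In a join, a set of vertices meeting both sides induces a connected graph. Therefore only
subsets of one side and the whole vertex set compete for the maximum, and a nonempty set with
the cut point property must contain one of the two sides.
-/

section PolynomialHeight

variable {R A : Type*} [CommRing R] [CommRing A]

instance liesOver_ker_eval₂RingHom (φ : R →+* A) (a : A) :
    (RingHom.ker (Polynomial.eval₂RingHom φ a)).LiesOver (RingHom.ker φ) :=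
  ⟨by ext; simp [Ideal.mem_comap, RingHom.mem_ker]⟩

theorem not_ker_eval₂RingHom_le_map_C {φ : R →+* A} {a : A} (h : IsAlgebraic φ.range a) :
    ¬ RingHom.ker (Polynomial.eval₂RingHom φ a) ≤ (RingHom.ker φ).map Polynomial.C := by
  obtain ⟨q, hq, hqa⟩ := h
  obtain ⟨Q, rfl⟩ := Polynomial.map_surjective φ.rangeRestrict φ.rangeRestrict_surjective q
  have hQ : Q ∈ RingHom.ker (Polynomial.eval₂RingHom φ a) := by
    rw [Polynomial.aeval_def, Polynomial.eval₂_map] at hqa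
    exact hqa
  refine fun hle => hq (Polynomial.ext fun n => Subtype.ext ?_)
  simpa using Ideal.mem_map_C_iff.1 (hle hQ) n

variable [IsNoetherianRing R] [IsDomain A]

theorem height_ker_le_height_ker_eval₂RingHom (φ : R →+* A) (a : A) :
    (RingHom.ker φ).height ≤ (RingHom.ker (Polynomial.eval₂RingHom φ a)).height := by
  have := RingHom.ker_isPrime φ
  have := RingHom.ker_isPrime (Polynomial.eval₂RingHom φ a)
  rw [Ideal.height_eq_height_add_of_liesOver_of_hasGoingDown (RingHom.ker φ)
    (RingHom.ker (Polynomial.eval₂RingHom φ a))]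
  exact le_self_add

theorem height_ker_add_one_le_height_ker_eval₂RingHom {φ : R →+* A} {a : A}
    (h : IsAlgebraic φ.range a) :
    (RingHom.ker φ).height + 1 ≤ (RingHom.ker (Polynomial.eval₂RingHom φ a)).height := by
  have := RingHom.ker_isPrime φ
  have := RingHom.ker_isPrime (Polynomial.eval₂RingHom φ a)
  have : ((RingHom.ker φ).map (algebraMap R (Polynomial R))).IsPrime :=
    Ideal.isPrime_map_C_of_isPrime
  rw [Ideal.height_eq_height_add_of_liesOver_of_hasGoingDown (RingHom.ker φ)
    (RingHom.ker (Polynomial.eval₂RingHom φ a))]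
  gcongr
  rw [Order.one_le_iff_ne_zero, Ne, Ideal.height_eq_zero_iff_eq_bot,
    Ideal.map_eq_bot_iff_le_ker, Ideal.mk_ker]
  exact not_ker_eval₂RingHom_le_map_C h

end PolynomialHeight

section DimensionInequality

open MvPolynomial

variable {K A : Type*} [Field K] [CommRing A] [Algebra K A]

theorem ker_aeval_option {σ : Type*} (f : Option σ → A) :
    RingHom.ker (aeval (R := K) f) =
      (RingHom.ker (Polynomial.eval₂RingHom (aeval (R := K) (f ∘ some)).toRingHom (f none))).comap
        (optionEquivLeft K σ).toRingEquiv := by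
  have : (aeval (R := K) f).toRingHom =
      (Polynomial.eval₂RingHom (aeval (R := K) (f ∘ some)).toRingHom (f none)).comp
        (optionEquivLeft K σ).toRingEquiv.toRingHom := by
    refine MvPolynomial.ringHom_ext (fun r => ?_) (fun i => ?_)
    · simp [optionEquivLeft_apply, algebraMap_eq, Polynomial.algebraMap_apply]
    · cases i <;> simp [optionEquivLeft_apply]
  exact congrArg RingHom.ker this

theorem height_ker_aeval_comp_some_le [IsDomain A] {σ : Type*} [Finite σ] (f : Option σ → A) :
    (RingHom.ker (aeval (R := K) (f ∘ some))).height ≤ (RingHom.ker (aeval (R := K) f)).height := by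
  rw [ker_aeval_option, RingEquiv.height_comap]
  exact height_ker_le_height_ker_eval₂RingHom _ _

theorem height_ker_aeval_comp_some_add_one_le [IsDomain A] {σ : Type*} [Finite σ]
    {f : Option σ → A} (h : IsAlgebraic (aeval (R := K) (f ∘ some)).range (f none)) :
    (RingHom.ker (aeval (R := K) (f ∘ some))).height + 1 ≤
      (RingHom.ker (aeval (R := K) f)).height := by
  rw [ker_aeval_option, RingEquiv.height_comap]
  exact height_ker_add_one_le_height_ker_eval₂RingHom h

theorem exists_algebraicIndepOn_card_le_height_ker_add_encard [IsDomain A] {σ : Type*} [Finite σ]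
    (f : σ → A) :
    ∃ s : Set σ, AlgebraicIndepOn K f s ∧
      ENat.card σ ≤ (RingHom.ker (aeval (R := K) f)).height + s.encard := by
  induction σ using Finite.induction_empty_option with
  | @of_equiv σ τ e ih =>
    obtain ⟨s, hs, hle⟩ := ih (f ∘ e)
    have hker : RingHom.ker (aeval (R := K) (f ∘ e)) =
        (RingHom.ker (aeval (R := K) f)).comap (renameEquiv K e).toRingEquiv := by
      ext p
      simp [RingHom.mem_ker, aeval_rename]
    refine ⟨e '' s, hs.image_of_comp s e f, ?_⟩
    rwa [hker, RingEquiv.height_comap, ENat.card_congr e, ← e.injective.encard_image] at hle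
  | h_empty => exact ⟨∅, by simp [FaithfulSMul.algebraMap_injective], by simp⟩
  | @h_option σ _ ih =>
    obtain ⟨s, hs, hle⟩ := ih (f ∘ some)
    have hs' : AlgebraicIndepOn K f (some '' s) := hs.image_of_comp s some f
    have hcard : ENat.card (Option σ) = ENat.card σ + 1 := by simp
    rw [← (Option.some_injective σ).encard_image] at hle
    -- Either the new element is algebraic over the old ones and the kernel gains height, or the
    -- independent set can be enlarged.
    by_cases halg : IsAlgebraic (aeval (R := K) (f ∘ some)).range (f none)
    · refine ⟨some '' s, hs', ?_⟩
      grw [hcard, hle, add_right_comm, height_ker_aeval_comp_some_add_one_le halg]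
    · have hadjoin : Algebra.adjoin K (f '' (some '' s)) ≤ (aeval (R := K) (f ∘ some)).range := by
        rw [Algebra.adjoin_le_iff, Set.image_image]
        rintro _ ⟨i, -, rfl⟩
        exact ⟨X i, by simp⟩
      refine ⟨insert none (some '' s),
        hs'.insert fun h => halg (h.tower_top_of_subalgebra_le hadjoin), ?_⟩
      grw [hcard, hle, height_ker_aeval_comp_some_le f,
        Set.encard_insert_of_notMem (by simp), add_assoc]

theorem encard_le_card_of_algebraicIndepOn {σ τ : Type*} {f : σ → A} {s : Set σ}
    (hs : AlgebraicIndepOn K f s) (g : τ → A)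
    (hfg : ∀ i, f i ∈ Algebra.adjoin K (Set.range g)) : s.encard ≤ ENat.card τ := by
  simp only [Algebra.adjoin_range_eq_range_aeval, AlgHom.mem_range] at hfg
  choose p hp using hfg
  have hp_indep : AlgebraicIndependent K fun i : s => p i :=
    AlgebraicIndependent.of_comp (aeval g) (by simpa only [Function.comp_def, hp] using hs)
  have hle := hp_indep.lift_cardinalMk_le_trdeg
  rw [trdeg_of_isDomain] at hle
  rw [← ENat.card_coe_set_eq, ENat.card, ENat.card]
  simpa using Cardinal.toENat.monotone' hle

theorem card_le_height_ker_aeval_add_card [IsDomain A] {σ τ : Type*} [Finite σ]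
    (f : σ → A) (g : τ → A) (hfg : ∀ i, f i ∈ Algebra.adjoin K (Set.range g)) :
    ENat.card σ ≤ (RingHom.ker (aeval (R := K) f)).height + ENat.card τ := by
  obtain ⟨s, hs, hle⟩ := exists_algebraicIndepOn_card_le_height_ker_add_encard (K := K) f
  exact hle.trans (by gcongr; exact encard_le_card_of_algebraicIndepOn hs g hfg)

end DimensionInequality

section ChainsOfPrimes

variable {R : Type*} [CommRing R]

theorem height_head_add_length_le_ringKrullDim (s : LTSeries (PrimeSpectrum R)) :
    ((s.head.asIdeal.height + s.length : ℕ∞) : WithBot ℕ∞) ≤ ringKrullDim R := by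
  have : Nonempty (PrimeSpectrum R) := ⟨s.head⟩
  rw [ringKrullDim, Order.krullDim_eq_iSup_height_add_coheight_of_nonempty,
    PrimeSpectrum.height_eq_orderHeight]
  exact WithBot.coe_le_coe.2
    (le_iSup_of_le s.head (add_le_add_right Order.length_le_coheight_head _))

theorem length_le_ringKrullDim_quotient {I : Ideal R} (s : LTSeries (PrimeSpectrum R))
    (hs : I ≤ s.head.asIdeal) : (s.length : WithBot ℕ∞) ≤ ringKrullDim (R ⧸ I) := by
  rw [ringKrullDim_quotient]
  exact Order.LTSeries.length_le_krullDim (α := PrimeSpectrum.zeroLocus (R := R) I)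
    ⟨s.length, fun i => ⟨s i, hs.trans (s.head_le i)⟩, s.step⟩

theorem le_height_iff_forall_prime {I : Ideal R} {n : ℕ∞} :
    n ≤ I.height ↔ ∀ P : Ideal R, P.IsPrime → I ≤ P → n ≤ P.height := by
  refine ⟨fun h P _ hIP => h.trans (Ideal.height_mono hIP), fun h => ?_⟩
  rw [Ideal.height_eq_inf_minimalPrimes]
  exact le_iInf₂ fun P hP => h P hP.1.1 hP.1.2

variable {I : Ideal R} {n : ℕ} (hn : ringKrullDim R = n) {s : LTSeries (PrimeSpectrum R)}
include hn

theorem height_add_length_eq (hs : I ≤ s.head.asIdeal)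
    (hle : ∀ P : Ideal R, P.IsPrime → I ≤ P → n ≤ P.height + s.length) :
    I.height + s.length = n := by
  refine le_antisymm ?_ ?_
  · have := height_head_add_length_le_ringKrullDim s
    rw [hn] at this
    grw [hs]
    exact_mod_cast this
  · rw [← tsub_le_iff_right, le_height_iff_forall_prime]
    exact fun P hP hIP => tsub_le_iff_right.2 (hle P hP hIP)

theorem ringKrullDim_quotient_le_of_le_height_add {d : ℕ}
    (hle : ∀ P : Ideal R, P.IsPrime → I ≤ P → n ≤ P.height + d) :
    ringKrullDim (R ⧸ I) ≤ d := by
  rw [ringKrullDim_quotient]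
  refine iSup_le fun t => ?_
  let t' := t.map Subtype.val (Subtype.strictMono_coe _)
  have hlower := hle _ t'.head.2 t.head.2
  have hupper := height_head_add_length_le_ringKrullDim t'
  rw [hn] at hupper
  norm_cast at hupper ⊢
  have hfin : t'.head.asIdeal.height ≠ ⊤ := fun h => by simp [h] at hupper
  lift t'.head.asIdeal.height to ℕ using hfin with h
  norm_cast at *
  have : t'.length = t.length := rfl
  omega

end ChainsOfPrimes

theorem exists_ltSeries_head_eq_of_strictMono {τ α : Type*} [Finite τ] [Preorder α]
    {F : Set τ → α} (hF : StrictMono F) :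
    ∃ s : LTSeries α, s.head = F ∅ ∧ s.length = Nat.card τ := by
  let e := Finite.equivFin τ
  let W : Fin (Nat.card τ + 1) → Set τ := fun k => {t | (e t).castSucc < k}
  have hW : StrictMono W := by
    refine Fin.strictMono_iff_lt_succ.2 fun k => (Set.ssubset_iff_of_subset ?_).2 ?_
    · exact fun t ht => lt_trans ht k.castSucc_lt_succ
    · exact ⟨e.symm k, by simp [W], by simp [W]⟩
  refine ⟨LTSeries.mk _ _ (hF.comp hW), congrArg F ?_, rfl⟩
  exact Set.eq_empty_of_forall_notMem fun t => Fin.not_lt_zero _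

section MonomialPrimes

open MvPolynomial

variable {R τ : Type*} [CommRing R]

theorem ker_killCompl_compl (W : Set τ) :
    RingHom.ker (killCompl (R := R) (Subtype.val_injective (p := (· ∈ Wᶜ)))) =
      Ideal.span (X '' W) := by
  ext p
  rw [mem_ideal_span_X_image, RingHom.mem_ker]
  refine ⟨fun hp m hm => ?_, fun hp => ?_⟩
  · by_contra! hmW
    have hrange : (m.support : Set τ) ⊆ Set.range ((↑) : (Wᶜ : Set τ) → τ) := fun i hi =>
      ⟨⟨i, fun hiW => Finsupp.mem_support_iff.1 hi (hmW i hiW)⟩, rfl⟩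
    have hcoeff := congrArg (coeff (m.comapDomain _ Subtype.val_injective.injOn)) hp
    rw [coeff_killCompl, Finsupp.mapDomain_comapDomain _ Subtype.val_injective _ hrange] at hcoeff
    exact mem_support_iff.1 hm hcoeff
  · ext m
    rw [coeff_killCompl, coeff_zero, ← notMem_support_iff]
    intro hm
    obtain ⟨i, hiW, hi⟩ := hp _ hm
    exact hi (Finsupp.mapDomain_of_notMem_range _ _ (by simpa using hiW))

theorem isPrime_span_X_image [IsDomain R] (W : Set τ) :
    (Ideal.span (X '' W : Set (MvPolynomial τ R))).IsPrime :=
  ker_killCompl_compl (R := R) W ▸ RingHom.ker_isPrime _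

theorem X_mem_span_X_image_iff [Nontrivial R] {W : Set τ} {t : τ} :
    (X t : MvPolynomial τ R) ∈ Ideal.span (X '' W) ↔ t ∈ W := by
  classical
  simp [mem_ideal_span_X_image, support_X, Finsupp.single_apply]

theorem one_add_X_notMem_span_X_image [Nontrivial R] (W : Set τ) (t : τ) :
    (1 + X t : MvPolynomial τ R) ∉ Ideal.span (X '' W) := fun h => by
  obtain ⟨i, -, hi⟩ := mem_ideal_span_X_image.1 h 0 (by simp)
  exact hi rfl

end MonomialPrimes

section Components

open SimpleGraph

variable {V W : Type*} {G : SimpleGraph V} {H : SimpleGraph W}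

/-- The number of connected components of the subgraph of `G` induced on `U`, as a natural number.
For `U = V \ T` this is the number usually written `c(T)`. -/
noncomputable def numComponents (G : SimpleGraph V) (U : Set V) : ℕ :=
  Nat.card (G.induce U).ConnectedComponent

theorem card_connectedComponent_congr (e : G ≃g H) :
    Nat.card G.ConnectedComponent = Nat.card H.ConnectedComponent :=
  Nat.card_congr e.connectedComponentEquiv

theorem numComponents_image (φ : G ↪g H) (U : Set V) :
    numComponents H (φ '' U) = numComponents G U :=
  (card_connectedComponent_congr
    ⟨Equiv.Set.image φ U φ.injective, by rintro ⟨a, ha⟩ ⟨b, hb⟩; simp⟩).symm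

theorem numComponents_empty : numComponents G ∅ = 0 := by
  have : IsEmpty (G.induce (∅ : Set V)).ConnectedComponent := ⟨fun c => c.ind fun v => v.2.elim⟩
  exact Nat.card_of_isEmpty

theorem numComponents_pos [Finite V] {U : Set V} (hU : U.Nonempty) : 0 < numComponents G U := by
  have : Nonempty (G.induce U).ConnectedComponent := ⟨(G.induce U).connectedComponentMk
    ⟨hU.some, hU.some_mem⟩⟩
  exact Nat.card_pos

theorem numComponents_eq_one_of_forall_reachable {U : Set V} (u : U)
    (h : ∀ v, (G.induce U).Reachable v u) : numComponents G U = 1 :=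
  Nat.card_eq_one_iff_exists.2 ⟨(G.induce U).connectedComponentMk u, fun c =>
    c.ind fun v => ConnectedComponent.sound (h v)⟩

theorem apply_eq_of_reachable {α : Type*} {f : V → α} (hf : ∀ v w, G.Adj v w → f v = f w)
    {v w : V} (h : G.Reachable v w) : f v = f w := by
  obtain ⟨p⟩ := h
  induction p with
  | nil => rfl
  | cons hadj _ ih => exact (hf _ _ hadj).trans ih

/-- A function on the vertices that is constant along edges, as a function on the components. -/
def componentLift {α : Type*} (f : V → α) (hf : ∀ v w, G.Adj v w → f v = f w) :
    G.ConnectedComponent → α :=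
  ConnectedComponent.lift f fun _ _ p _ => apply_eq_of_reachable hf p.reachable

theorem sigma_connectedComponentMk_eq {ι : Type*} (p : V → ι) {i : ι} (v : V) (hv : p v = i) :
    (⟨p v, (G.induce (p ⁻¹' {p v})).connectedComponentMk ⟨v, rfl⟩⟩ :
      Σ i, (G.induce (p ⁻¹' {i})).ConnectedComponent) =
      ⟨i, (G.induce (p ⁻¹' {i})).connectedComponentMk ⟨v, hv⟩⟩ := by
  subst hv
  rfl

/-- If `p` is constant along edges, then the components of `G` are those of the fibres of `p`. -/
def connectedComponentEquivSigmaFiber {ι : Type*} (p : V → ι)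
    (hp : ∀ v w, G.Adj v w → p v = p w) :
    G.ConnectedComponent ≃ Σ i, (G.induce (p ⁻¹' {i})).ConnectedComponent where
  toFun := componentLift (fun v => ⟨p v, (G.induce _).connectedComponentMk ⟨v, rfl⟩⟩)
    fun v w h => by
      rw [sigma_connectedComponentMk_eq p v (hp v w h), Sigma.mk.injEq]
      exact ⟨rfl, heq_of_eq (ConnectedComponent.connectedComponentMk_eq_of_adj h)⟩
  invFun x := x.2.map (Embedding.induce _).toHom
  left_inv c := c.ind fun _ => rfl
  right_inv := fun ⟨_, c⟩ => c.ind fun v => sigma_connectedComponentMk_eq p v.1 v.2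

theorem preimage_val_iUnion_image_val {ι : Type*} (c : ι ≃ G.ConnectedComponent)
    (A : ∀ i, Set (c i)) (i : ι) :
    (Subtype.val ⁻¹' ⋃ j, (Subtype.val '' A j : Set V) : Set (c i)) = A i := by
  ext v
  simp only [Set.mem_preimage, Set.mem_iUnion]
  constructor
  · rintro ⟨j, w, hw, hwv⟩
    obtain rfl : j = i := c.injective (w.2.symm.trans (hwv ▸ v.2))
    rwa [← Subtype.ext hwv]
  · exact fun hv => ⟨i, v, hv, rfl⟩

theorem iUnion_image_val_preimage_val {ι : Type*} (c : ι ≃ G.ConnectedComponent) (T : Set V) :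
    ⋃ i, (Subtype.val '' (Subtype.val ⁻¹' T : Set (c i)) : Set V) = T := by
  ext v
  simp only [Set.mem_iUnion]
  constructor
  · rintro ⟨i, w, hw, rfl⟩
    exact hw
  · exact fun hv => ⟨c.symm (G.connectedComponentMk v),
      ⟨v, (c.apply_symm_apply _).symm⟩, hv, rfl⟩

variable [Finite V] {ι : Type*} [Fintype ι] (c : ι ≃ G.ConnectedComponent)

theorem numComponents_eq_sum (U : Set V) :
    numComponents G U = ∑ i, numComponents (c i).toSimpleGraph (Subtype.val ⁻¹' U) := by
  have hadj : ∀ v w : U, (G.induce U).Adj v w →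
      c.symm (G.connectedComponentMk v) = c.symm (G.connectedComponentMk w) :=
    fun v w h => congrArg c.symm (ConnectedComponent.connectedComponentMk_eq_of_adj h)
  rw [numComponents, Nat.card_congr (connectedComponentEquivSigmaFiber _ hadj), Nat.card_sigma]
  refine Finset.sum_congr rfl fun i _ => card_connectedComponent_congr
    ⟨⟨fun v => ⟨⟨v.1.1, c.symm_apply_eq.1 v.2⟩, v.1.2⟩,
      fun v => ⟨⟨v.1.1, v.2⟩, c.symm_apply_eq.2 v.1.2⟩, fun _ => rfl, fun _ => rfl⟩, Iff.rfl⟩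

theorem ncard_eq_sum (U : Set V) :
    U.ncard = ∑ i, (Subtype.val ⁻¹' U : Set (c i)).ncard := by
  simp only [← Nat.card_coe_set_eq, ← Nat.card_sigma]
  refine Nat.card_congr ⟨fun v => ⟨c.symm (G.connectedComponentMk v.1),
    ⟨⟨v.1, (c.apply_symm_apply _).symm⟩, v.2⟩⟩, fun x => ⟨x.2.1.1, x.2.2⟩, fun _ => rfl, ?_⟩
  rintro ⟨i, ⟨v, hv⟩, h⟩
  obtain rfl : c.symm (G.connectedComponentMk v) = i := c.symm_apply_eq.2 hv
  rfl

theorem card_eq_sum : Nat.card V = ∑ i, Nat.card (c i) := by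
  simpa only [Set.ncard_univ, Set.preimage_univ] using ncard_eq_sum c Set.univ

end Components

/-- The maximum of `|U| + c(G[U])` over all `U ⊆ V`, where `c` counts connected components and
`U` stands for the complement of the set called `T` in the definition of `𝒞(G)`. It is the
dimension of `K[x_v, y_v : v ∈ V] / J_G`, see `ringKrullDim_quotient_binomialEdgeIdeal`. -/
noncomputable def binomialEdgeDim {V : Type*} (G : SimpleGraph V) : ℕ :=
  ⨆ U : Set V, (U.ncard + numComponents G U)

section BinomialEdgeDim

variable {V : Type*} [Finite V] (G : SimpleGraph V)

theorem le_binomialEdgeDim (U : Set V) : U.ncard + numComponents G U ≤ binomialEdgeDim G :=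
  le_ciSup (f := fun U : Set V => U.ncard + numComponents G U) (Set.finite_range _).bddAbove U

theorem exists_eq_binomialEdgeDim :
    ∃ U : Set V, U.ncard + numComponents G U = binomialEdgeDim G :=
  exists_eq_ciSup_of_finite

variable {G} in
theorem sum_binomialEdgeDim {ι : Type*} [Fintype ι] (c : ι ≃ G.ConnectedComponent) :
    ∑ i, binomialEdgeDim (c i).toSimpleGraph = binomialEdgeDim G := by
  have hsum (U : Set V) : U.ncard + numComponents G U =
      ∑ i, ((Subtype.val ⁻¹' U : Set (c i)).ncard +
        numComponents (c i).toSimpleGraph (Subtype.val ⁻¹' U)) := by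
    rw [Finset.sum_add_distrib, ← ncard_eq_sum, ← numComponents_eq_sum]
  apply le_antisymm
  · choose A hA using fun i => exists_eq_binomialEdgeDim (c i).toSimpleGraph
    refine le_trans (le_of_eq ?_) (le_binomialEdgeDim G (⋃ i, Subtype.val '' A i))
    simp only [hsum, preimage_val_iUnion_image_val, hA]
  · obtain ⟨U, hU⟩ := exists_eq_binomialEdgeDim G
    rw [← hU, hsum]
    exact Finset.sum_le_sum fun i _ => le_binomialEdgeDim _ _

end BinomialEdgeDim

section PrimesOverBinomialEdgeIdeal

open MvPolynomial

variable {K : Type*} [Field K] {V : Type*} {G : SimpleGraph V}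

theorem binomialEdgeIdeal_le_iff {I : Ideal (EdgeRing K V)} :
    binomialEdgeIdeal K G ≤ I ↔
      ∀ v w, G.Adj v w → X (0, v) * X (1, w) - X (0, w) * X (1, v) ∈ I := by
  rw [binomialEdgeIdeal, Ideal.span_le]
  exact ⟨fun h v w hvw => h ⟨v, w, hvw, rfl⟩, by rintro h _ ⟨v, w, hvw, rfl⟩; exact h v w hvw⟩

section Lower

variable (K G) (U : Set V)

open Classical in
/-- A parametrisation of part of the zero set of `J_G`, with a slope `X (inl c)` for each component
`c` of `G[U]` and a scale `1 + X (inr v)` for each `v ∈ U`. The scale is shifted by `1` in order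
that no prime ideal generated by variables contains it. -/
noncomputable def slopeScaleParam (p : Fin 2 × V) :
    MvPolynomial ((G.induce U).ConnectedComponent ⊕ U) K :=
  if h : p.2 ∈ U then
    (if p.1 = 0 then X (Sum.inl ((G.induce U).connectedComponentMk ⟨p.2, h⟩)) else 1) *
      (1 + X (Sum.inr ⟨p.2, h⟩))
  else 0

variable {K G U}

theorem slopeScaleParam_zero {v : V} (h : v ∈ U) : slopeScaleParam K G U (0, v) =
    X (Sum.inl ((G.induce U).connectedComponentMk ⟨v, h⟩)) * (1 + X (Sum.inr ⟨v, h⟩)) := by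
  simp [slopeScaleParam, h]

theorem slopeScaleParam_one {v : V} (h : v ∈ U) :
    slopeScaleParam K G U (1, v) = 1 + X (Sum.inr ⟨v, h⟩) := by
  simp [slopeScaleParam, h]

theorem slopeScaleParam_of_notMem {v : V} (h : v ∉ U) (i : Fin 2) :
    slopeScaleParam K G U (i, v) = 0 := by
  simp [slopeScaleParam, h]

theorem binomialEdgeIdeal_le_ker_slopeScaleParam :
    binomialEdgeIdeal K G ≤ RingHom.ker (aeval (R := K) (slopeScaleParam K G U)) := by
  refine binomialEdgeIdeal_le_iff.2 fun v w hvw => ?_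
  simp only [RingHom.mem_ker, map_sub, map_mul, aeval_X]
  by_cases hv : v ∈ U; swap
  · simp only [slopeScaleParam_of_notMem hv, zero_mul, mul_zero, sub_zero]
  by_cases hw : w ∈ U; swap
  · simp only [slopeScaleParam_of_notMem hw, zero_mul, mul_zero, sub_zero]
  have hcomp : (G.induce U).connectedComponentMk ⟨v, hv⟩ =
      (G.induce U).connectedComponentMk ⟨w, hw⟩ :=
    SimpleGraph.ConnectedComponent.connectedComponentMk_eq_of_adj hvw
  rw [slopeScaleParam_zero hv, slopeScaleParam_zero hw, slopeScaleParam_one hv,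
    slopeScaleParam_one hw, hcomp]
  ring

theorem strictMono_comap_span_X_image :
    StrictMono fun W : Set ((G.induce U).ConnectedComponent ⊕ U) =>
      PrimeSpectrum.comap (aeval (R := K) (slopeScaleParam K G U)).toRingHom
        ⟨Ideal.span (X '' W), isPrime_span_X_image W⟩ := by
  refine Monotone.strictMono_of_injective
    (fun W W' h => Ideal.comap_mono (Ideal.span_mono (Set.image_mono h))) fun W W' h => ?_
  have hmem (p : EdgeRing K V) : aeval (slopeScaleParam K G U) p ∈ Ideal.span (X '' W) ↔
      aeval (slopeScaleParam K G U) p ∈ Ideal.span (X '' W') :=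
    SetLike.ext_iff.1 (congrArg PrimeSpectrum.asIdeal h) p
  ext (c | ⟨v, hv⟩)
  · obtain ⟨⟨v, hv⟩, rfl⟩ := c.exists_rep
    have := hmem (X (0, v))
    rwa [aeval_X, slopeScaleParam_zero hv, (isPrime_span_X_image _).mul_mem_iff_mem_or_mem,
      (isPrime_span_X_image _).mul_mem_iff_mem_or_mem,
      or_iff_left (one_add_X_notMem_span_X_image _ _),
      or_iff_left (one_add_X_notMem_span_X_image _ _), X_mem_span_X_image_iff,
      X_mem_span_X_image_iff] at this
  · have := hmem (X (1, v) - 1)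
    rwa [map_sub, map_one, aeval_X, slopeScaleParam_one hv, add_sub_cancel_left,
      X_mem_span_X_image_iff, X_mem_span_X_image_iff] at this

theorem exists_ltSeries_binomialEdgeIdeal_le [Finite V] (U : Set V) :
    ∃ s : LTSeries (PrimeSpectrum (EdgeRing K V)),
      binomialEdgeIdeal K G ≤ s.head.asIdeal ∧ s.length = U.ncard + numComponents G U := by
  obtain ⟨s, hhead, hlength⟩ :=
    exists_ltSeries_head_eq_of_strictMono (strictMono_comap_span_X_image (K := K) (G := G) (U := U))
  refine ⟨s, ?_, by rw [hlength, Nat.card_sum, add_comm, Nat.card_coe_set_eq, numComponents]⟩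
  rw [hhead]
  exact binomialEdgeIdeal_le_ker_slopeScaleParam.trans (Ideal.comap_mono bot_le)

end Lower

section Upper

theorem div_eq_div_of_mul_eq_mul {L : Type*} [Field L] {a b c d : L} (h : a * d = c * b)
    (hab : a ≠ 0 ∨ b ≠ 0) (hcd : c ≠ 0 ∨ d ≠ 0) : a / b = c / d := by
  by_cases hb : b = 0
  · have hd : d = 0 := by simp_all
    rw [hb, hd, div_zero, div_zero]
  · have hd : d ≠ 0 := by rintro rfl; simp_all
    rwa [div_eq_div_iff hb hd]

theorem exists_slope_scale_mem_adjoin {L : Type*} [Field L] [Algebra K L] (x y : V → L)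
    (h : ∀ v w, G.Adj v w → x v * y w = x w * y v) :
    ∃ (U : Set V) (g : (G.induce U).ConnectedComponent ⊕ U → L),
      ∀ v, x v ∈ Algebra.adjoin K (Set.range g) ∧ y v ∈ Algebra.adjoin K (Set.range g) := by
  classical
  let U : Set V := {v | x v ≠ 0 ∨ y v ≠ 0}
  -- The slope of a component with `y = 0` is the junk value `x / 0 = 0`; there `x` is the scale.
  let slope : (G.induce U).ConnectedComponent → L := componentLift (fun v => x v / y v)
    fun v w hvw => div_eq_div_of_mul_eq_mul (h v w hvw) v.2 w.2
  let scale : U → L := fun v => if y v = 0 then x v else y v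
  have hslope (v : V) (hv : v ∈ U) : x v / y v ∈
      Algebra.adjoin K (Set.range (Sum.elim slope scale)) :=
    Algebra.subset_adjoin ⟨Sum.inl ((G.induce U).connectedComponentMk ⟨v, hv⟩), rfl⟩
  have hscale (v : V) (hv : v ∈ U) : (if y v = 0 then x v else y v) ∈
      Algebra.adjoin K (Set.range (Sum.elim slope scale)) :=
    Algebra.subset_adjoin ⟨Sum.inr ⟨v, hv⟩, rfl⟩
  refine ⟨U, Sum.elim slope scale, fun v => ?_⟩
  by_cases hv : v ∈ U
  · specialize hslope v hv
    specialize hscale v hv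
    by_cases hy : y v = 0
    · rw [if_pos hy] at hscale
      exact ⟨hscale, hy ▸ zero_mem _⟩
    · rw [if_neg hy] at hscale
      exact ⟨div_mul_cancel₀ (x v) hy ▸ mul_mem hslope hscale, hscale⟩
  · obtain ⟨hx, hy⟩ : x v = 0 ∧ y v = 0 := by simpa [U, not_or] using hv
    exact ⟨hx ▸ zero_mem _, hy ▸ zero_mem _⟩

theorem two_mul_card_le_height_add_binomialEdgeDim [Finite V] (P : Ideal (EdgeRing K V))
    (hP : P.IsPrime) (hGP : binomialEdgeIdeal K G ≤ P) :
    (2 * Nat.card V : ℕ) ≤ P.height + binomialEdgeDim G := by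
  let L := FractionRing (EdgeRing K V ⧸ P)
  let f : Fin 2 × V → L := fun p => algebraMap (EdgeRing K V ⧸ P) L (Ideal.Quotient.mk P (X p))
  have haeval (p : EdgeRing K V) :
      aeval f p = algebraMap (EdgeRing K V ⧸ P) L (Ideal.Quotient.mk P p) := by
    have : aeval f = (IsScalarTower.toAlgHom K (EdgeRing K V ⧸ P) L).comp
        (Ideal.Quotient.mkₐ K P) := by ext; simp [f]
    exact DFunLike.congr_fun this p
  have hker : RingHom.ker (aeval (R := K) f) = P := by
    ext p
    rw [RingHom.mem_ker, haeval, FaithfulSMul.algebraMap_eq_zero_iff,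
      Ideal.Quotient.eq_zero_iff_mem]
  have hadj (v w : V) (hvw : G.Adj v w) : f (0, v) * f (1, w) = f (0, w) * f (1, v) := by
    have := binomialEdgeIdeal_le_iff.1 (hGP.trans hker.ge) v w hvw
    simpa only [RingHom.mem_ker, map_sub, map_mul, aeval_X, sub_eq_zero] using this
  obtain ⟨U, g, hg⟩ := exists_slope_scale_mem_adjoin (K := K) _ _ hadj
  have hle := card_le_height_ker_aeval_add_card (K := K) f g
    fun ⟨i, v⟩ => by fin_cases i; exacts [(hg v).1, (hg v).2]
  have hcard : ENat.card ((G.induce U).ConnectedComponent ⊕ U) ≤ binomialEdgeDim G := by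
    rw [ENat.card_eq_coe_natCard, Nat.card_sum, add_comm]
    exact_mod_cast le_binomialEdgeDim G U
  rw [hker, ENat.card_eq_coe_natCard, Nat.card_prod, Nat.card_fin] at hle
  exact hle.trans (by gcongr)

end Upper

end PrimesOverBinomialEdgeIdeal

section HeightAndDimension

variable (K : Type*) [Field K] {V : Type*} [Finite V] (G : SimpleGraph V)

theorem ringKrullDim_edgeRing : ringKrullDim (EdgeRing K V) = (2 * Nat.card V : ℕ) := by
  rw [MvPolynomial.ringKrullDim_of_isNoetherianRing, ringKrullDim_eq_zero_of_field, zero_add,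
    Nat.card_prod, Nat.card_fin]

theorem exists_ltSeries_length_eq_binomialEdgeDim :
    ∃ s : LTSeries (PrimeSpectrum (EdgeRing K V)),
      binomialEdgeIdeal K G ≤ s.head.asIdeal ∧ s.length = binomialEdgeDim G := by
  obtain ⟨U, hU⟩ := exists_eq_binomialEdgeDim G
  exact hU ▸ exists_ltSeries_binomialEdgeIdeal_le U

theorem height_binomialEdgeIdeal_add_binomialEdgeDim :
    (binomialEdgeIdeal K G).height + binomialEdgeDim G = (2 * Nat.card V : ℕ) := by
  obtain ⟨s, hhead, hlength⟩ := exists_ltSeries_length_eq_binomialEdgeDim K G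
  rw [← hlength]
  refine height_add_length_eq (ringKrullDim_edgeRing K) hhead ?_
  rw [hlength]
  exact two_mul_card_le_height_add_binomialEdgeDim

theorem ringKrullDim_quotient_binomialEdgeIdeal :
    ringKrullDim (EdgeRing K V ⧸ binomialEdgeIdeal K G) = binomialEdgeDim G := by
  obtain ⟨s, hhead, hlength⟩ := exists_ltSeries_length_eq_binomialEdgeDim K G
  refine le_antisymm ?_ (hlength ▸ length_le_ringKrullDim_quotient s hhead)
  exact ringKrullDim_quotient_le_of_le_height_add (ringKrullDim_edgeRing K)
    two_mul_card_le_height_add_binomialEdgeDim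

variable {G} {ι : Type*} [Fintype ι] (c : ι ≃ G.ConnectedComponent)

theorem sum_height_binomialEdgeIdeal :
    ∑ i, (binomialEdgeIdeal K (c i).toSimpleGraph).height = (binomialEdgeIdeal K G).height := by
  have hsum : ∑ i, (binomialEdgeIdeal K (c i).toSimpleGraph).height + binomialEdgeDim G =
      (binomialEdgeIdeal K G).height + binomialEdgeDim G := by
    rw [height_binomialEdgeIdeal_add_binomialEdgeDim, ← sum_binomialEdgeDim c, Nat.cast_sum,
      ← Finset.sum_add_distrib, card_eq_sum c, Finset.mul_sum, Nat.cast_sum]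
    exact Finset.sum_congr rfl fun i _ => height_binomialEdgeIdeal_add_binomialEdgeDim K _
  exact ENat.add_left_injective_of_ne_top (ENat.natCast_ne_top _) hsum

theorem sum_ringKrullDim_quotient_binomialEdgeIdeal :
    ∑ i, ringKrullDim (EdgeRing K (c i) ⧸ binomialEdgeIdeal K (c i).toSimpleGraph) =
      ringKrullDim (EdgeRing K V ⧸ binomialEdgeIdeal K G) := by
  simp only [ringKrullDim_quotient_binomialEdgeIdeal, ← sum_binomialEdgeDim c, Nat.cast_sum]

end HeightAndDimension

theorem sum_lt_sum_iff_of_forall_ne_eq {ι M : Type*} [Fintype ι] [AddCommMonoid M] [Preorder M]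
    [AddRightReflectLT M] [AddRightStrictMono M] {f g : ι → M} (i : ι)
    (h : ∀ j ≠ i, f j = g j) : ∑ j, f j < ∑ j, g j ↔ f i < g i := by
  classical
  rw [Fintype.sum_eq_add_sum_compl i f, Fintype.sum_eq_add_sum_compl i g,
    Finset.sum_congr rfl fun j hj => h j (by simpa using hj), add_lt_add_iff_right]

section CutPointSets

variable {V W : Type*} {G : SimpleGraph V}

theorem mem_cutPointSets_iff {T : Set V} :
    T ∈ cutPointSets G ↔ ∀ i ∈ T, numComponents G (insert i Tᶜ) < numComponents G Tᶜ := by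
  have hprop : T ∈ cutPointSets G ↔ HasCutPointProperty G T :=
    or_iff_right_of_imp fun h => h ▸ fun _ hi => hi.elim
  rw [hprop]
  refine forall₂_congr fun i hi => ?_
  let e : (G.induce (Tᶜ ∪ {i})).induce {w | w ≠ ⟨i, Or.inr rfl⟩} ≃g G.induce Tᶜ :=
    { toFun := fun w => ⟨w.1.1, w.1.2.resolve_right fun h => w.2 (Subtype.ext h)⟩
      invFun := fun w =>
        ⟨⟨w.1, Or.inl w.2⟩, fun h => w.2 (by rwa [show w.1 = i from congrArg Subtype.val h])⟩
      left_inv := fun _ => rfl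
      right_inv := fun _ => rfl
      map_rel_iff' := Iff.rfl }
  rw [IsCutPoint, card_connectedComponent_congr e, ← Set.union_singleton, numComponents,
    numComponents]

theorem compl_mem_cutPointSets_iff {U : Set V} :
    Uᶜ ∈ cutPointSets G ↔ ∀ i ∉ U, numComponents G (insert i U) < numComponents G U := by
  rw [mem_cutPointSets_iff, compl_compl]
  rfl

theorem nonempty_of_compl_mem_cutPointSets [Nonempty V] {U : Set V} (hU : Uᶜ ∈ cutPointSets G) :
    U.Nonempty := by
  by_contra! hempty
  obtain ⟨v⟩ := ‹Nonempty V›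
  have := compl_mem_cutPointSets_iff.1 hU v (by simp [hempty])
  rw [hempty, numComponents_empty] at this
  exact Nat.not_lt_zero _ this

theorem mem_iJoinCollections_liftCollection_iff {ι : Type*} (c : ι ≃ G.ConnectedComponent)
    {𝒜 : ∀ i, Set (Set (c i))} {T : Set V} :
    T ∈ iJoinCollections (fun i => liftCollection (c i) (𝒜 i)) ↔
      ∀ i, Subtype.val ⁻¹' T ∈ 𝒜 i := by
  constructor
  · rintro ⟨A, hA, rfl⟩ i
    choose B hB hAB using hA
    obtain rfl : A = fun i => Subtype.val '' B i := funext hAB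
    rw [preimage_val_iUnion_image_val]
    exact hB i
  · exact fun h => ⟨fun i => Subtype.val '' (Subtype.val ⁻¹' T), fun i => ⟨_, h i, rfl⟩,
      (iUnion_image_val_preimage_val c T).symm⟩

variable [Finite V]

section ConnectedComponents

variable {ι : Type*} (c : ι ≃ G.ConnectedComponent)

theorem compl_mem_cutPointSets_iff_forall_component {U : Set V} :
    Uᶜ ∈ cutPointSets G ↔
      ∀ i, (Subtype.val ⁻¹' U : Set (c i))ᶜ ∈ cutPointSets (c i).toSimpleGraph := by
  have := Finite.of_equiv _ c.symm
  have := Fintype.ofFinite ι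
  have hlocal (i : ι) (v : c i) :
      numComponents G (insert v.1 U) < numComponents G U ↔
        numComponents (c i).toSimpleGraph (insert v (Subtype.val ⁻¹' U)) <
          numComponents (c i).toSimpleGraph (Subtype.val ⁻¹' U) := by
    rw [numComponents_eq_sum c, numComponents_eq_sum c U, sum_lt_sum_iff_of_forall_ne_eq i,
      show (Subtype.val ⁻¹' insert v.1 U : Set (c i)) = insert v (Subtype.val ⁻¹' U) by
        ext w; exact or_congr_left Subtype.ext_iff.symm]
    intro j hj
    congr 1
    ext w
    have hwv : w.1 ≠ v.1 := fun h => hj (c.injective (w.2.symm.trans (h ▸ v.2)))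
    simp [hwv]
  simp only [compl_mem_cutPointSets_iff]
  refine ⟨fun h i v hv => (hlocal i v).1 (h v hv), fun h v hv => ?_⟩
  have hv' : G.connectedComponentMk v = c (c.symm (G.connectedComponentMk v)) :=
    (c.apply_symm_apply _).symm
  exact (hlocal _ ⟨v, hv'⟩).2 (h _ ⟨v, hv'⟩ hv)

theorem iJoinCollections_liftCollection_cutPointSets :
    (iJoinCollections fun i => liftCollection (c i) (cutPointSets (c i).toSimpleGraph)) =
      cutPointSets G := by
  ext T
  rw [mem_iJoinCollections_liftCollection_iff, ← compl_compl T,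
    compl_mem_cutPointSets_iff_forall_component c]
  rfl

end ConnectedComponents

theorem card_connectedComponent_le_numComponents {U : Set V} (hU : Uᶜ ∈ cutPointSets G) :
    Nat.card G.ConnectedComponent ≤ numComponents G U := by
  have := Fintype.ofFinite G.ConnectedComponent
  let c := Equiv.refl G.ConnectedComponent
  rw [numComponents_eq_sum c, Nat.card_eq_fintype_card, Fintype.card_eq_sum_ones]
  refine Finset.sum_le_sum fun i _ => numComponents_pos ?_
  have : Nonempty (c i) := (c i).nonempty_supp.to_subtype
  exact nonempty_of_compl_mem_cutPointSets
    ((compl_mem_cutPointSets_iff_forall_component c).1 hU i)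

theorem compl_image_mem_cutPointSets_iff {H : SimpleGraph W} (φ : G ↪g H)
    (hφ : ∀ w ∉ Set.range φ, ∀ v, H.Adj (φ v) w) (hG : 2 ≤ Nat.card G.ConnectedComponent)
    {U : Set V} : (φ '' U)ᶜ ∈ cutPointSets H ↔ Uᶜ ∈ cutPointSets G := by
  have hrange (v : V) : numComponents H (insert (φ v) (φ '' U)) < numComponents H (φ '' U) ↔
      numComponents G (insert v U) < numComponents G U := by
    rw [← Set.image_insert_eq, numComponents_image, numComponents_image]
  have hcone (w : W) (hw : w ∉ Set.range φ) : numComponents H (insert w (φ '' U)) = 1 := by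
    refine numComponents_eq_one_of_forall_reachable ⟨w, Set.mem_insert _ _⟩ ?_
    rintro ⟨_, rfl | ⟨v, -, rfl⟩⟩
    · rfl
    · exact SimpleGraph.Adj.reachable (hφ w hw v)
  refine ⟨fun h => compl_mem_cutPointSets_iff.2 fun v hv => ?_, fun h => ?_⟩
  · exact (hrange v).1 (compl_mem_cutPointSets_iff.1 h _ (by simpa using hv))
  · refine compl_mem_cutPointSets_iff.2 fun w hw => ?_
    by_cases hwr : w ∈ Set.range φ
    · obtain ⟨v, rfl⟩ := hwr
      exact (hrange v).2 (compl_mem_cutPointSets_iff.1 h v (by simpa using hw))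
    · rw [hcone w hwr, numComponents_image]
      exact hG.trans (card_connectedComponent_le_numComponents h)

end CutPointSets

section GraphJoin

variable {V W : Type*} (G : SimpleGraph V) (H : SimpleGraph W)

/-- The first graph as an induced subgraph of the join. -/
def graphJoinInl : G ↪g graphJoin G H := ⟨⟨Sum.inl, Sum.inl_injective⟩, by simp [graphJoin]⟩

/-- The second graph as an induced subgraph of the join. -/
def graphJoinInr : H ↪g graphJoin G H := ⟨⟨Sum.inr, Sum.inr_injective⟩, by simp [graphJoin]⟩

theorem graphJoin_adj_inl_inr (v : V) (w : W) : (graphJoin G H).Adj (Sum.inl v) (Sum.inr w) := by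
  simp [graphJoin]

theorem numComponents_graphJoin_inl_image (A : Set V) :
    numComponents (graphJoin G H) (Sum.inl '' A) = numComponents G A :=
  numComponents_image (graphJoinInl G H) A

theorem numComponents_graphJoin_inr_image (B : Set W) :
    numComponents (graphJoin G H) (Sum.inr '' B) = numComponents H B :=
  numComponents_image (graphJoinInr G H) B

theorem numComponents_graphJoin_eq_one {U : Set (V ⊕ W)} {a : V} {b : W} (ha : Sum.inl a ∈ U)
    (hb : Sum.inr b ∈ U) : numComponents (graphJoin G H) U = 1 := by
  have hadj (v : V) (w : W) (hv : Sum.inl v ∈ U) (hw : Sum.inr w ∈ U) :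
      ((graphJoin G H).induce U).Reachable ⟨Sum.inl v, hv⟩ ⟨Sum.inr w, hw⟩ :=
    SimpleGraph.Adj.reachable (graphJoin_adj_inl_inr G H v w)
  refine numComponents_eq_one_of_forall_reachable ⟨_, ha⟩ ?_
  rintro ⟨v | w, hx⟩
  · exact (hadj v b hx hb).trans (hadj a b ha hb).symm
  · exact (hadj a w ha hx).symm

theorem eq_inl_image_or_eq_inr_image_or_exists_inl_inr_mem (U : Set (V ⊕ W)) :
    (∃ A, U = Sum.inl '' A) ∨ (∃ B, U = Sum.inr '' B) ∨
      ∃ a b, Sum.inl a ∈ U ∧ Sum.inr b ∈ U := by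
  by_cases hinl : U ⊆ Set.range Sum.inl
  · obtain ⟨A, rfl⟩ := Set.subset_range_iff_exists_image_eq.1 hinl
    exact Or.inl ⟨A, rfl⟩
  by_cases hinr : U ⊆ Set.range Sum.inr
  · obtain ⟨B, rfl⟩ := Set.subset_range_iff_exists_image_eq.1 hinr
    exact Or.inr (Or.inl ⟨B, rfl⟩)
  obtain ⟨a | _, ha, hainr⟩ := Set.not_subset.1 hinr; swap
  · exact (hainr ⟨_, rfl⟩).elim
  obtain ⟨_ | b, hb, hbinl⟩ := Set.not_subset.1 hinl
  · exact (hbinl ⟨_, rfl⟩).elim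
  exact Or.inr (Or.inr ⟨a, b, ha, hb⟩)

theorem inl_image_union_range_inr (A : Set V) :
    Sum.inl '' A ∪ Set.range Sum.inr = (Sum.inl '' Aᶜ : Set (V ⊕ W))ᶜ := by
  ext (v | w) <;> simp

theorem inr_image_union_range_inl (B : Set W) :
    Sum.inr '' B ∪ Set.range Sum.inl = (Sum.inr '' Bᶜ : Set (V ⊕ W))ᶜ := by
  ext (v | w) <;> simp

variable {G H}

theorem eq_empty_of_mem_cutPointSets_graphJoin {T : Set (V ⊕ W)}
    (hT : T ∈ cutPointSets (graphJoin G H)) {a : V} {b : W} (ha : Sum.inl a ∈ Tᶜ)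
    (hb : Sum.inr b ∈ Tᶜ) : T = ∅ := by
  refine Set.eq_empty_iff_forall_notMem.2 fun i hi => ?_
  have hlt := mem_cutPointSets_iff.1 hT i hi
  rw [numComponents_graphJoin_eq_one G H ha hb,
    numComponents_graphJoin_eq_one G H (Or.inr ha) (Or.inr hb)] at hlt
  exact lt_irrefl 1 hlt

theorem inl_image_union_range_inr_mem_cutPointSets_iff [Finite V]
    (hG : 2 ≤ Nat.card G.ConnectedComponent) {A : Set V} :
    Sum.inl '' A ∪ Set.range Sum.inr ∈ cutPointSets (graphJoin G H) ↔ A ∈ cutPointSets G := by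
  rw [inl_image_union_range_inr, ← compl_compl A, compl_compl Aᶜ]
  refine compl_image_mem_cutPointSets_iff (graphJoinInl G H) ?_ hG
  rintro (v | w) h u
  · exact (h ⟨v, rfl⟩).elim
  · exact graphJoin_adj_inl_inr G H u w

theorem inr_image_union_range_inl_mem_cutPointSets_iff [Finite W]
    (hH : 2 ≤ Nat.card H.ConnectedComponent) {B : Set W} :
    Sum.inr '' B ∪ Set.range Sum.inl ∈ cutPointSets (graphJoin G H) ↔ B ∈ cutPointSets H := by
  rw [inr_image_union_range_inl, ← compl_compl B, compl_compl Bᶜ]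
  refine compl_image_mem_cutPointSets_iff (graphJoinInr G H) ?_ hH
  rintro (v | w) h u
  · exact (graphJoin_adj_inl_inr G H v u).symm
  · exact (h ⟨w, rfl⟩).elim

variable [Finite V] [Finite W]

theorem mem_cutPointSets_graphJoin_iff (hG : 2 ≤ Nat.card G.ConnectedComponent)
    (hH : 2 ≤ Nat.card H.ConnectedComponent) {T : Set (V ⊕ W)} :
    T ∈ cutPointSets (graphJoin G H) ↔
      T = ∅ ∨ (∃ A ∈ cutPointSets G, T = Sum.inl '' A ∪ Set.range Sum.inr) ∨
        ∃ B ∈ cutPointSets H, T = Sum.inr '' B ∪ Set.range Sum.inl := by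
  constructor
  · intro hT
    rcases eq_inl_image_or_eq_inr_image_or_exists_inl_inr_mem Tᶜ with
      ⟨A, hA⟩ | ⟨B, hB⟩ | ⟨a, b, ha, hb⟩
    · obtain rfl : T = Sum.inl '' Aᶜ ∪ Set.range Sum.inr := by
        rw [inl_image_union_range_inr, compl_compl, ← hA, compl_compl]
      exact Or.inr (Or.inl ⟨_, (inl_image_union_range_inr_mem_cutPointSets_iff hG).1 hT, rfl⟩)
    · obtain rfl : T = Sum.inr '' Bᶜ ∪ Set.range Sum.inl := by
        rw [inr_image_union_range_inl, compl_compl, ← hB, compl_compl]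
      exact Or.inr (Or.inr ⟨_, (inr_image_union_range_inl_mem_cutPointSets_iff hH).1 hT, rfl⟩)
    · exact Or.inl (eq_empty_of_mem_cutPointSets_graphJoin hT ha hb)
  · rintro (rfl | ⟨A, hA, rfl⟩ | ⟨B, hB, rfl⟩)
    · exact Or.inl rfl
    · exact (inl_image_union_range_inr_mem_cutPointSets_iff hG).2 hA
    · exact (inr_image_union_range_inl_mem_cutPointSets_iff hH).2 hB

theorem cutPointSets_graphJoin (hG : 2 ≤ Nat.card G.ConnectedComponent)
    (hH : 2 ≤ Nat.card H.ConnectedComponent) :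
    cutPointSets (graphJoin G H) =
      {∅} ∪ joinCollections (Set.image Sum.inl '' cutPointSets G) {Set.range Sum.inr}
        ∪ joinCollections (Set.image Sum.inr '' cutPointSets H) {Set.range Sum.inl} := by
  ext T
  simp [mem_cutPointSets_graphJoin_iff hG hH, joinCollections, or_assoc]

variable (G H) [Nonempty V] [Nonempty W]

theorem binomialEdgeDim_graphJoin :
    binomialEdgeDim (graphJoin G H) =
      max (binomialEdgeDim G) (max (binomialEdgeDim H) (Nat.card V + Nat.card W + 1)) := by
  have hinl (A : Set V) : A.ncard + numComponents G A =
      (Sum.inl '' A : Set (V ⊕ W)).ncard + numComponents (graphJoin G H) (Sum.inl '' A) := by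
    rw [numComponents_graphJoin_inl_image, Set.ncard_image_of_injective _ Sum.inl_injective]
  have hinr (B : Set W) : B.ncard + numComponents H B =
      (Sum.inr '' B : Set (V ⊕ W)).ncard + numComponents (graphJoin G H) (Sum.inr '' B) := by
    rw [numComponents_graphJoin_inr_image, Set.ncard_image_of_injective _ Sum.inr_injective]
  apply le_antisymm
  · obtain ⟨U, hU⟩ := exists_eq_binomialEdgeDim (graphJoin G H)
    rw [← hU]
    rcases eq_inl_image_or_eq_inr_image_or_exists_inl_inr_mem U with
      ⟨A, rfl⟩ | ⟨B, rfl⟩ | ⟨a, b, ha, hb⟩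
    · exact hinl A ▸ le_max_of_le_left (le_binomialEdgeDim G A)
    · exact hinr B ▸ le_max_of_le_right (le_max_of_le_left (le_binomialEdgeDim H B))
    · rw [numComponents_graphJoin_eq_one G H ha hb, ← Nat.card_sum]
      grw [Set.ncard_le_card U]
      exact le_max_of_le_right (le_max_right _ _)
  · refine max_le ?_ (max_le ?_ ?_)
    · obtain ⟨A, hA⟩ := exists_eq_binomialEdgeDim G
      exact hA ▸ hinl A ▸ le_binomialEdgeDim _ _
    · obtain ⟨B, hB⟩ := exists_eq_binomialEdgeDim H
      exact hB ▸ hinr B ▸ le_binomialEdgeDim _ _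
    · have huniv := le_binomialEdgeDim (graphJoin G H) Set.univ
      rwa [numComponents_graphJoin_eq_one G H (Set.mem_univ (Sum.inl (Classical.arbitrary V)))
        (Set.mem_univ (Sum.inr (Classical.arbitrary W))), Set.ncard_univ, Nat.card_sum] at huniv

variable (K : Type*) [Field K]

theorem height_binomialEdgeIdeal_graphJoin :
    (binomialEdgeIdeal K (graphJoin G H)).height =
      min (2 * (Nat.card W : ℕ∞) + (binomialEdgeIdeal K G).height)
        (min (2 * (Nat.card V : ℕ∞) + (binomialEdgeIdeal K H).height)
          ((Nat.card V + Nat.card W - 1 : ℕ) : ℕ∞)) := by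
  have hG := height_binomialEdgeIdeal_add_binomialEdgeDim K G
  have hH := height_binomialEdgeIdeal_add_binomialEdgeDim K H
  have hGH := height_binomialEdgeIdeal_add_binomialEdgeDim K (graphJoin G H)
  have hfin {h : ℕ∞} {d n : ℕ} (hd : h + d = n) : h ≠ ⊤ := by rintro rfl; simp at hd
  have hV : 0 < Nat.card V := Nat.card_pos
  rw [binomialEdgeDim_graphJoin, Nat.card_sum] at hGH
  obtain ⟨a, ha⟩ := ENat.ne_top_iff_exists.1 (hfin hG)
  obtain ⟨b, hb⟩ := ENat.ne_top_iff_exists.1 (hfin hH)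
  obtain ⟨h, hh⟩ := ENat.ne_top_iff_exists.1 (hfin hGH)
  rw [← ha] at hG ⊢
  rw [← hb] at hH ⊢
  rw [← hh] at hGH ⊢
  norm_cast at hG hH hGH ⊢
  rw [← Nat.mono_cast.map_min, ← Nat.mono_cast.map_min, Nat.cast_inj]
  omega

theorem ringKrullDim_quotient_binomialEdgeIdeal_graphJoin :
    ringKrullDim (EdgeRing K (V ⊕ W) ⧸ binomialEdgeIdeal K (graphJoin G H)) =
      max (ringKrullDim (EdgeRing K V ⧸ binomialEdgeIdeal K G))
        (max (ringKrullDim (EdgeRing K W ⧸ binomialEdgeIdeal K H))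
          ((Nat.card V + Nat.card W + 1 : ℕ) : WithBot ℕ∞)) := by
  simp only [ringKrullDim_quotient_binomialEdgeIdeal, binomialEdgeDim_graphJoin,
    ← Nat.mono_cast.map_max]

end GraphJoin

theorem proposition4p10 {K : Type*} [Field K] {V₁ V₂ : Type*} [Fintype V₁] [Fintype V₂]
    (G₁ : SimpleGraph V₁) (G₂ : SimpleGraph V₂) {r s : ℕ} (hr : 2 ≤ r) (hs : 2 ≤ s)
    (c₁ : Fin r ≃ G₁.ConnectedComponent) (c₂ : Fin s ≃ G₂.ConnectedComponent) :
    -- (a) the sets with the cut point property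
    (cutPointSets (graphJoin G₁ G₂) =
      {∅}
      ∪ joinCollections
          (Set.image Sum.inl '' iJoinCollections fun i : Fin r =>
            liftCollection (c₁ i) (cutPointSets (c₁ i).toSimpleGraph))
          {Set.range Sum.inr}
      ∪ joinCollections
          (Set.image Sum.inr '' iJoinCollections fun j : Fin s =>
            liftCollection (c₂ j) (cutPointSets (c₂ j).toSimpleGraph))
          {Set.range Sum.inl})
    -- (b) the height
    ∧ (binomialEdgeIdeal K (graphJoin G₁ G₂)).height =
        min (2 * (Fintype.card V₂ : ℕ∞)
              + ∑ i : Fin r, (binomialEdgeIdeal K (c₁ i).toSimpleGraph).height)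
          (min (2 * (Fintype.card V₁ : ℕ∞)
              + ∑ j : Fin s, (binomialEdgeIdeal K (c₂ j).toSimpleGraph).height)
            ((Fintype.card V₁ + Fintype.card V₂ - 1 : ℕ) : ℕ∞))
    -- (c) the dimension
    ∧ ringKrullDim (EdgeRing K (V₁ ⊕ V₂) ⧸ binomialEdgeIdeal K (graphJoin G₁ G₂)) =
        max (∑ i : Fin r,
              ringKrullDim (EdgeRing K (c₁ i) ⧸ binomialEdgeIdeal K (c₁ i).toSimpleGraph))
          (max (∑ j : Fin s,
              ringKrullDim (EdgeRing K (c₂ j) ⧸ binomialEdgeIdeal K (c₂ j).toSimpleGraph))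
            ((Fintype.card V₁ + Fintype.card V₂ + 1 : ℕ) : WithBot ℕ∞)) := by
  have hcard₁ : 2 ≤ Nat.card G₁.ConnectedComponent := by rwa [← Nat.card_congr c₁, Nat.card_fin]
  have hcard₂ : 2 ≤ Nat.card G₂.ConnectedComponent := by rwa [← Nat.card_congr c₂, Nat.card_fin]
  have : Nonempty V₁ := ⟨(c₁ ⟨0, by lia⟩).nonempty_supp.some⟩
  have : Nonempty V₂ := ⟨(c₂ ⟨0, by lia⟩).nonempty_supp.some⟩
  simp only [← Nat.card_eq_fintype_card]
  refine ⟨?_, ?_, ?_⟩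
  · rw [iJoinCollections_liftCollection_cutPointSets, iJoinCollections_liftCollection_cutPointSets]
    exact cutPointSets_graphJoin hcard₁ hcard₂
  · rw [sum_height_binomialEdgeIdeal, sum_height_binomialEdgeIdeal]
    exact height_binomialEdgeIdeal_graphJoin G₁ G₂ K
  · rw [sum_ringKrullDim_quotient_binomialEdgeIdeal, sum_ringKrullDim_quotient_binomialEdgeIdeal]
    exact ringKrullDim_quotient_binomialEdgeIdeal_graphJoin G₁ G₂ K
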